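/- Let $\tau$ be a complex number with $\operatorname{Im}\tau>0$, let $q:=e^{2\pi i\tau}$, and for rational $r$ let $q^{r}:=e^{2\pi i r\tau}$. Let $J_1:=\prod_{i\ge 1}(1-q^{i})$. For integers $N\ge 1$, $\ell\in\{0,1,\dots,N\}$ and $m\equiv\ell\pmod 2$, the string function $\mathcal{C}^{N}_{m,\ell}(q)$ of the affine Lie algebra of type $A_1^{(1)}$ is, in its normalization without the leading fractional power of $q$, $$\mathcal{C}_{m,\ell}^N(q)=\frac{1}{J_{1}^3}\sum_{j\in\mathbb{Z}}\Bigl(\sum_{i\in\mathbb{N}} (-1)^i q^{\frac{1}{2}i(i+m)+j((N+2)j+\ell+1)}\Bigl\{q^{\frac{1}{2}i(2(N+2)j+\ell+1)}-q^{-\frac{1}{2}i(2(N+2)j+\ell+1)}\Bigr\}\Bigr),$$ where the sum over $i$ is taken first. **Theorem 2.4.** Let $N=1$, $\ell\in\{0,1\}$, and let $m$ be any integer with $m\equiv\ell\pmod 2$. Then the inner series over $i$ converges absolutely for every $j\in\mathbb{Z}$, the outer series over $j$ converges absolutely, and $$q^{-\frac14(m^2-\ell^2)}\,J_1^3\,\mathcal{C}^1_{m,\ell}(q)=J_1^2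 .$$ -/

import Mathlib

/-- The power `q ^ r` of the nome `q = exp (2 π i τ)`, that is `exp (2 π i r τ)`, for a point `τ` of
the upper half-plane and a rational exponent `r`. -/
noncomputable def qPow (τ : UpperHalfPlane) (r : ℚ) : ℂ :=
  Complex.exp (2 * (Real.pi : ℂ) * Complex.I * (r : ℂ) * (τ : ℂ))

/-- The Euler product `J_k = ∏_{i ≥ 1} (1 - q ^ (k i))`; the index is shifted to start at `0`. -/
noncomputable def eulerJ (k : ℕ) (τ : UpperHalfPlane) : ℂ :=
  ∏' i : ℕ, (1 - qPow τ ((k : ℚ) * ((i : ℚ) + 1)))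

/-- The term with indices `j ∈ ℤ`, `i ∈ ℕ` of the double series for the string function of level `N`:
`(-1)^i q^{i(i+m)/2 + j((N+2)j+ℓ+1)} (q^{i(2(N+2)j+ℓ+1)/2} - q^{-i(2(N+2)j+ℓ+1)/2})`.
It vanishes for `i = 0`. -/
noncomputable def stringTerm (N : ℕ) (m ℓ : ℤ) (τ : UpperHalfPlane) (j : ℤ) (i : ℕ) : ℂ :=
  (-1) ^ i
    * qPow τ ((1 / 2 : ℚ) * (i : ℚ) * ((i : ℚ) + (m : ℚ))
        + (j : ℚ) * (((N : ℚ) + 2) * (j : ℚ) + (ℓ : ℚ) + 1))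
    * (qPow τ ((1 / 2 : ℚ) * (i : ℚ) * (2 * ((N : ℚ) + 2) * (j : ℚ) + (ℓ : ℚ) + 1))
        - qPow τ (-((1 / 2 : ℚ) * (i : ℚ) * (2 * ((N : ℚ) + 2) * (j : ℚ) + (ℓ : ℚ) + 1))))

/-- The (normalized) string function `𝒞^N_{m,ℓ}(q)` of the affine Lie algebra of type `A_1^{(1)}`.
The double series is an iterated one, summed over `i` first: its terms are not absolutely summable
over pairs `(j, i)`. -/
noncomputable def stringC (N : ℕ) (m ℓ : ℤ) (τ : UpperHalfPlane) : ℂ :=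
  1 / eulerJ 1 τ ^ 3 * ∑' j : ℤ, ∑' i : ℕ, stringTerm N m ℓ τ j i

open Filter Topology

namespace StringFunction

/-! Write P(n) = ∑_{i≥0} (-1)^i q^{i(i+1)/2+in} and θ(z) = ∑_k (-1)^k q^{k(k-1)/2} z^k. Behind the
proof is the expansion of J₁³/θ(z) as ∑_n P(n) z^n in the annulus |q| < |z| < 1. It is used only
through coefficients: θ convolved with P is J₁³ at 0 and vanishes elsewhere
(`thetaConvolution_eq_zero`, `thetaConvolution_zero`). The vanishing comes from a first-order
recurrence for P, the value at 0 from Jacobi's series for J₁³.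

Put m = 2p + ℓ and φ(n) = q^{n²+nℓ}. Multiplying ∑ φ(n) z^n by θ and then by its inverse recovers φ
up to J₁³, so ∑_n D(n) P(p-n) = J₁³ φ(p), where D(n) are the coefficients of θ(z) ∑ φ(n) z^n.
Completing the square in D(n) gives, according to n mod 3, a pentagonal series (hence ±J₁ times a
power of q) or an antisymmetric series (hence 0). The two surviving classes pair up to J₁ times the
string series, whose inner sum over i is a difference of two values of P. One factor J₁ cancels, and
φ(p) = q^{(m²-ℓ²)/4}. -/

/-! ### Powers of the nome and series with quadratic exponents -/

lemma qPow_zero (τ : UpperHalfPlane) : qPow τ 0 = 1 := by simp [qPow]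

lemma qPow_add (τ : UpperHalfPlane) (a b : ℚ) : qPow τ (a + b) = qPow τ a * qPow τ b := by
  simp only [qPow, ← Complex.exp_add]
  push_cast
  ring_nf

lemma qPow_nsmul (τ : UpperHalfPlane) (a : ℚ) (n : ℕ) : qPow τ (n * a) = qPow τ a ^ n := by
  simp only [qPow, ← Complex.exp_nat_mul]
  push_cast
  ring_nf

lemma norm_qPow (τ : UpperHalfPlane) (a : ℚ) :
    ‖qPow τ a‖ = Real.exp (-(2 * Real.pi * τ.im) * a) := by
  rw [qPow, Complex.norm_exp, show (2 * (Real.pi : ℂ) * Complex.I * (a : ℂ) * (τ : ℂ)) =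
    ((2 * Real.pi * a : ℝ) : ℂ) * (τ : ℂ) * Complex.I by push_cast; ring]
  rw [Complex.mul_I_re, Complex.im_ofReal_mul, UpperHalfPlane.coe_im]
  ring_nf

lemma norm_qPow_le_one (τ : UpperHalfPlane) {a : ℚ} (ha : 0 ≤ a) : ‖qPow τ a‖ ≤ 1 := by
  rw [norm_qPow, Real.exp_le_one_iff]
  have := τ.im_pos
  have h : (0 : ℝ) ≤ a := by exact_mod_cast ha
  have : 0 ≤ 2 * Real.pi * τ.im * a := by positivity
  linarith

lemma qPow_ne_one (τ : UpperHalfPlane) {a : ℚ} (ha : a ≠ 0) : qPow τ a ≠ 1 := by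
  intro h
  have h1 := norm_qPow τ a
  rw [h, norm_one, eq_comm, Real.exp_eq_one_iff] at h1
  have := τ.im_pos
  have h2 : (a : ℝ) ≠ 0 := by exact_mod_cast ha
  have h3 : 2 * Real.pi * τ.im ≠ 0 := by positivity
  simp_all

lemma norm_qPow_one_lt (τ : UpperHalfPlane) : ‖qPow τ 1‖ < 1 := by
  rw [norm_qPow, Real.exp_lt_one_iff]
  have := τ.im_pos
  have : 0 < 2 * Real.pi * τ.im := by positivity
  push_cast
  linarith

/-- Identification with Jacobi theta terms reduces convergence of quadratic-exponent series, with or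
without a factor k, to the known criteria for the two-variable theta function and its z-derivative.
-/
lemma qPow_quadratic (τ : UpperHalfPlane) (a b c : ℚ) (k : ℤ) :
    qPow τ (a * k ^ 2 + b * k + c) =
      jacobiTheta₂_term k ((b : ℂ) * τ) (2 * (a : ℂ) * τ) * qPow τ c := by
  rw [qPow_add]
  congr 1
  simp only [qPow, jacobiTheta₂_term]
  push_cast
  ring_nf

lemma im_two_mul_mul_pos (τ : UpperHalfPlane) {a : ℚ} (ha : 0 < a) :
    0 < (2 * (a : ℂ) * (τ : ℂ)).im := by
  rw [show (2 * (a : ℂ) * (τ : ℂ)) = ((2 * a : ℝ) : ℂ) * τ by push_cast; ring,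
    Complex.im_ofReal_mul, UpperHalfPlane.coe_im]
  have := τ.im_pos
  have h2 : (0 : ℝ) < a := by exact_mod_cast ha
  positivity

lemma summable_qPow_quadratic (τ : UpperHalfPlane) {a : ℚ} (ha : 0 < a) (b c : ℚ) :
    Summable fun k : ℤ => qPow τ (a * k ^ 2 + b * k + c) := by
  simp only [qPow_quadratic]
  exact ((summable_jacobiTheta₂_term_iff _ _).2 (im_two_mul_mul_pos τ ha)).mul_right _

lemma summable_intCast_mul_qPow_quadratic (τ : UpperHalfPlane) {a : ℚ} (ha : 0 < a) (b c : ℚ) :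
    Summable fun k : ℤ => (k : ℂ) * qPow τ (a * k ^ 2 + b * k + c) := by
  have h := (((summable_jacobiTheta₂'_term_iff ((b : ℂ) * τ) _).2
    (im_two_mul_mul_pos τ ha)).mul_left (2 * Real.pi * Complex.I)⁻¹).mul_right (qPow τ c)
  refine h.congr fun k => ?_
  rw [qPow_quadratic, jacobiTheta₂'_term]
  have := Complex.two_pi_I_ne_zero
  field_simp

lemma norm_neg_one_zpow (k : ℤ) : ‖(-1 : ℂ) ^ k‖ = 1 := by simp

lemma summable_sign_mul {ι : Type*} {s g : ι → ℂ} (hs : ∀ i, ‖s i‖ = 1) (hg : Summable g) :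
    Summable fun i => s i * g i :=
  .of_norm_bounded hg.norm fun i => by simp [hs]

/-- A sum over the integers that changes sign under a reflection vanishes. -/
lemma tsum_eq_zero_of_reflection {g : ℤ → ℂ} (c : ℤ) (h : ∀ k, g (c - k) = -g k) :
    ∑' k, g k = 0 := by
  have h1 := (Equiv.subLeft c).tsum_eq g
  simp only [Equiv.subLeft_apply, h, tsum_neg] at h1
  linear_combination (-1 / 2 : ℂ) * h1

/-! ### Finite and infinite Euler products -/

/-- The finite Euler product `(q; q)_n`. -/
noncomputable def qFactorial (τ : UpperHalfPlane) (n : ℕ) : ℂ :=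
  ∏ i ∈ Finset.range n, (1 - qPow τ 1 ^ (i + 1))

lemma qFactorial_succ (τ : UpperHalfPlane) (n : ℕ) :
    qFactorial τ (n + 1) = qFactorial τ n * (1 - qPow τ 1 ^ (n + 1)) :=
  Finset.prod_range_succ _ _

lemma eulerJ_one (τ : UpperHalfPlane) : eulerJ 1 τ = ∏' i : ℕ, (1 - qPow τ 1 ^ (i + 1)) := by
  unfold eulerJ
  congr 1
  ext i
  rw [← qPow_nsmul]
  push_cast
  ring_nf

lemma one_sub_qPow_pow_ne_zero (τ : UpperHalfPlane) (i : ℕ) : 1 - qPow τ 1 ^ (i + 1) ≠ 0 := by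
  rw [← qPow_nsmul, sub_ne_zero]
  exact (qPow_ne_one τ (by positivity)).symm

lemma qFactorial_ne_zero (τ : UpperHalfPlane) (n : ℕ) : qFactorial τ n ≠ 0 :=
  Finset.prod_ne_zero_iff.2 fun i _ => one_sub_qPow_pow_ne_zero τ i

lemma eulerJ_one_ne_zero (τ : UpperHalfPlane) : eulerJ 1 τ ≠ 0 := by
  rw [eulerJ_one]
  refine tprod_one_add_ne_zero_of_summable (f := fun n ↦ -qPow τ 1 ^ (n + 1)) ?_ ?_
  · exact fun i ↦ by simpa [← sub_eq_add_neg] using one_sub_qPow_pow_ne_zero τ i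
  · simpa [summable_nat_add_iff] using
      (summable_geometric_of_lt_one (norm_nonneg _) (norm_qPow_one_lt τ))

lemma tendsto_qFactorial (τ : UpperHalfPlane) :
    Tendsto (qFactorial τ) atTop (𝓝 (eulerJ 1 τ)) := by
  rw [eulerJ_one]
  exact (ModularForm.multipliable_one_sub_pow (norm_qPow_one_lt τ)).tendsto_prod_tprod_nat

/-! ### Gaussian binomials and the finite triple product -/

/-- The Gaussian binomial coefficients in a parameter `q`. -/
noncomputable def gaussBinomial (q : ℂ) : ℕ → ℕ → ℂ
  | _, 0 => 1
  | 0, _ + 1 => 0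
  | n + 1, k + 1 => q ^ (k + 1) * gaussBinomial q n (k + 1) + gaussBinomial q n k

lemma gaussBinomial_zero_right (q : ℂ) (n : ℕ) : gaussBinomial q n 0 = 1 := by
  cases n <;> rfl

lemma gaussBinomial_eq_zero (q : ℂ) {n k : ℕ} (h : n < k) : gaussBinomial q n k = 0 := by
  induction n generalizing k with
  | zero => obtain ⟨k, rfl⟩ := Nat.exists_eq_succ_of_ne_zero h.ne'; rfl
  | succ n ih =>
    obtain ⟨k, rfl⟩ := Nat.exists_eq_succ_of_ne_zero (Nat.ne_zero_of_lt h)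
    simp [gaussBinomial, ih (show n < k by omega), ih (show n < k + 1 by omega)]

/-- The Pascal recursion matches the splitting 1 - q^{a+b} = (1 - q^a) + q^a (1 - q^b). -/
lemma gaussBinomial_mul_qFactorial (τ : UpperHalfPlane) (n : ℕ) :
    ∀ a b : ℕ, a + b = n → gaussBinomial (qPow τ 1) n a * (qFactorial τ a * qFactorial τ b) =
      qFactorial τ n := by
  induction n with
  | zero =>
    rintro a b h
    obtain ⟨rfl, rfl⟩ : a = 0 ∧ b = 0 := by omega
    simp [gaussBinomial_zero_right, qFactorial]
  | succ n ih =>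
    rintro (_ | a) b h
    · obtain rfl : b = n + 1 := by omega
      simp [gaussBinomial_zero_right, qFactorial]
    rcases b with _ | b
    · obtain rfl : a = n := by omega
      have h1 := ih a 0 rfl
      rw [gaussBinomial, gaussBinomial_eq_zero _ (Nat.lt_succ_self a), qFactorial_succ]
      linear_combination (1 - qPow τ 1 ^ (a + 1)) * h1
    · have h1 := ih a (b + 1) (by omega)
      have h2 := ih (a + 1) b (by omega)
      rw [gaussBinomial, qFactorial_succ τ n, show n + 1 = (a + 1) + (b + 1) by omega, pow_add]
      rw [qFactorial_succ] at h1 h2 ⊢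
      rw [qFactorial_succ τ b]
      linear_combination (1 - qPow τ 1 ^ (a + 1)) * h1 +
        qPow τ 1 ^ (a + 1) * (1 - qPow τ 1 ^ (b + 1)) * h2

/-- The finite **q-binomial theorem**. -/
lemma prod_one_add_eq_sum_gaussBinomial (q : ℂ) (n : ℕ) (x : ℂ) :
    ∏ i ∈ Finset.range n, (1 + q ^ i * x) =
      ∑ j ∈ Finset.range (n + 1), q ^ (j.choose 2) * gaussBinomial q n j * x ^ j := by
  induction n generalizing x with
  | zero => simp [gaussBinomial_zero_right]
  | succ n ih =>
    have h1 : ∀ i, 1 + q ^ (i + 1) * x = 1 + q ^ i * (q * x) := fun i => by ring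
    simp only [Finset.prod_range_succ', h1]
    rw [ih]
    have h2 : ∀ j, q ^ ((j + 1).choose 2) * gaussBinomial q (n + 1) (j + 1) * x ^ (j + 1) =
        q ^ ((j + 1).choose 2) * gaussBinomial q n (j + 1) * (q * x) ^ (j + 1) +
        q ^ (j.choose 2) * gaussBinomial q n j * (q * x) ^ j * x := by
      intro j
      rw [gaussBinomial, Nat.choose_succ_succ' j 1, Nat.choose_one_right]
      ring
    rw [Finset.sum_range_succ' _ (n + 1), Finset.sum_congr rfl fun j _ => h2 j,
      Finset.sum_add_distrib, ← Finset.sum_mul]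
    have h3 := Finset.sum_range_succ'
      (fun j => q ^ (j.choose 2) * gaussBinomial q n j * (q * x) ^ j) (n + 1)
    rw [Finset.sum_range_succ, gaussBinomial_eq_zero q (Nat.lt_succ_self n)] at h3
    simp only [gaussBinomial_zero_right] at h3 ⊢
    linear_combination h3

lemma qPow_one_pow_choose_two (τ : UpperHalfPlane) (j : ℕ) :
    qPow τ 1 ^ (j.choose 2) = qPow τ ((j : ℚ) * (j - 1) / 2) := by
  rw [← qPow_nsmul, Nat.cast_choose_two, mul_one]

lemma prod_one_sub_qPow_neg (τ : UpperHalfPlane) (n : ℕ) :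
    ∏ i ∈ Finset.range n, (1 - qPow τ ((i : ℚ) - n)) =
      (-1) ^ n * qPow τ (-((n : ℚ) * (n + 1) / 2)) * qFactorial τ n := by
  rw [← Finset.prod_range_reflect]
  have h : ∀ i ∈ Finset.range n, (1 - qPow τ (((n - 1 - i : ℕ) : ℚ) - n)) =
      1 - qPow τ (-((i : ℚ) + 1)) := by
    intro i hi
    rw [Finset.mem_range] at hi
    rw [Nat.sub_sub, Nat.cast_sub (by omega)]
    push_cast
    ring_nf
  rw [Finset.prod_congr rfl h]
  clear h
  induction n with
  | zero => simp [qFactorial, qPow_zero]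
  | succ n ih =>
    rw [Finset.prod_range_succ, ih, qFactorial_succ, ← qPow_nsmul]
    have h1 : qPow τ (-(((n + 1 : ℕ) : ℚ) * ((n + 1 : ℕ) + 1) / 2)) =
        qPow τ (-((n : ℚ) * (n + 1) / 2)) * qPow τ (-((n : ℚ) + 1)) := by
      rw [← qPow_add]; congr 1; push_cast; ring
    have h2 : qPow τ (-((n : ℚ) + 1)) * qPow τ (((n + 1 : ℕ) : ℚ) * 1) = 1 := by
      rw [← qPow_add, ← qPow_zero τ]; congr 1; push_cast; ring
    rw [h1]
    linear_combination (-(-1) ^ n * qPow τ (-((n : ℚ) * (n + 1) / 2)) * qFactorial τ n) * h2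

/-- The finite Jacobi triple product, with the vanishing factor at `z = 1` isolated. -/
lemma finite_triple_product (τ : UpperHalfPlane) (n : ℕ) (z : ℂ) :
    (∏ i ∈ Finset.range n, (1 - z * qPow τ ((i : ℚ) - n))) *
      (∏ i ∈ Finset.range n, (1 - z * qPow τ 1 ^ (i + 1))) * (1 - z) =
    ∑ j ∈ Finset.range (2 * n + 2), (-1) ^ j * qPow τ ((j : ℚ) * (j - 1) / 2 - n * j) *
      gaussBinomial (qPow τ 1) (2 * n + 1) j * z ^ j := by
  -- This choice of x centres the 2n+1 factors at 1 - z q^s with -n ≤ s ≤ n; s = 0 is the factor 1 -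
  -- z.
  have h := prod_one_add_eq_sum_gaussBinomial (qPow τ 1) (2 * n + 1) (-z * qPow τ (-n))
  rw [show 2 * n + 1 = n + (n + 1) by ring, Finset.prod_range_add, Finset.prod_range_succ'] at h
  rw [mul_assoc]
  convert h using 1
  · congr 1
    · refine Finset.prod_congr rfl fun i _ => ?_
      rw [← qPow_nsmul, sub_eq_add_neg (i : ℚ), qPow_add, mul_one]
      ring
    · congr 1
      · refine Finset.prod_congr rfl fun i _ => ?_
        rw [← qPow_nsmul, ← qPow_nsmul,
          show ((i + 1 : ℕ) : ℚ) * 1 = ((n + (i + 1) : ℕ) : ℚ) * 1 + -n by push_cast; ring,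
          qPow_add]
        ring
      · have h1 : qPow τ (n * 1) * qPow τ (-n) = 1 := by
          rw [← qPow_add, mul_one, add_neg_cancel, qPow_zero]
        rw [add_zero, ← qPow_nsmul]
        linear_combination z * h1
  · rw [show 2 * n + 2 = n + (n + 1) + 1 by ring]
    refine Finset.sum_congr rfl fun j _ => ?_
    rw [qPow_one_pow_choose_two, mul_pow, ← qPow_nsmul, sub_eq_add_neg, qPow_add,
      show (j : ℚ) * -(n : ℚ) = -((n : ℚ) * j) by ring, show n + (n + 1) = 2 * n + 1 by ring]
    rw [neg_pow]
    ring

lemma sum_gaussBinomial_eq_zero (τ : UpperHalfPlane) (n : ℕ) :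
    ∑ j ∈ Finset.range (2 * n + 2), (-1) ^ j * qPow τ ((j : ℚ) * (j - 1) / 2 - n * j) *
      gaussBinomial (qPow τ 1) (2 * n + 1) j = 0 := by
  simpa using (finite_triple_product τ n 1).symm

/-- Differentiate the finite triple product at z = 1: since 1 - z vanishes there, only minus the
remaining product survives. -/
lemma sum_natCast_mul_gaussBinomial (τ : UpperHalfPlane) (n : ℕ) :
    ∑ j ∈ Finset.range (2 * n + 2), (-1) ^ j * qPow τ ((j : ℚ) * (j - 1) / 2 - n * j) *
      gaussBinomial (qPow τ 1) (2 * n + 1) j * j =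
    -((-1) ^ n * qPow τ (-((n : ℚ) * (n + 1) / 2)) * qFactorial τ n ^ 2) := by
  set A : ℂ → ℂ := fun z => (∏ i ∈ Finset.range n, (1 - z * qPow τ ((i : ℚ) - n))) *
      (∏ i ∈ Finset.range n, (1 - z * qPow τ 1 ^ (i + 1))) with hA
  have hAd : Differentiable ℂ A := by
    refine Differentiable.mul ?_ ?_ <;>
      exact Differentiable.fun_finsetProd fun i _ => by fun_prop
  have h1 : HasDerivAt (fun z => A z * (1 - z)) (-A 1) 1 := by
    have h := (hAd 1).hasDerivAt.fun_mul ((hasDerivAt_id' (1 : ℂ)).const_sub 1)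
    rwa [sub_self, mul_zero, zero_add, mul_neg_one] at h
  have h2 : HasDerivAt (fun z : ℂ => ∑ j ∈ Finset.range (2 * n + 2),
      (-1) ^ j * qPow τ ((j : ℚ) * (j - 1) / 2 - n * j) *
      gaussBinomial (qPow τ 1) (2 * n + 1) j * z ^ j)
      (∑ j ∈ Finset.range (2 * n + 2), (-1) ^ j * qPow τ ((j : ℚ) * (j - 1) / 2 - n * j) *
      gaussBinomial (qPow τ 1) (2 * n + 1) j * j) 1 := by
    refine HasDerivAt.fun_sum fun j _ => ?_
    simpa using (hasDerivAt_pow j (1 : ℂ)).const_mul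
      ((-1) ^ j * qPow τ ((j : ℚ) * (j - 1) / 2 - n * j) * gaussBinomial (qPow τ 1) (2 * n + 1) j)
  rw [← funext (finite_triple_product τ n)] at h2
  rw [h2.unique h1, hA]
  simp only [one_mul, prod_one_sub_qPow_neg]
  rw [← qFactorial]
  ring

/-! ### Jacobi's identity for the cube of the Euler product -/

/-- The central-indexed Gaussian binomial coefficient `[2n+1, n+k]` weighting the finite form of
Jacobi's identity. -/
noncomputable def jacobiCoeff (τ : UpperHalfPlane) (n : ℕ) (k : ℤ) : ℂ :=
  if 0 ≤ k + n then gaussBinomial (qPow τ 1) (2 * n + 1) (k + n).toNat else 0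

lemma qFactorial_sq_eq_tsum (τ : UpperHalfPlane) (n : ℕ) :
    qFactorial τ n ^ 2 = ∑' k : ℤ,
      -((-1) ^ k * (k * qPow τ ((k : ℚ) * (k - 1) / 2))) * jacobiCoeff τ n k := by
  let i : ℕ ↪ ℤ := ⟨fun j => (j : ℤ) - n, fun a b h => by simpa using h⟩
  rw [tsum_eq_sum (s := (Finset.range (2 * n + 2)).map i)]
  · rw [Finset.sum_map]
    have h0 := sum_gaussBinomial_eq_zero τ n
    have h1 := sum_natCast_mul_gaussBinomial τ n
    have hq : qPow τ ((n : ℚ) * (n + 1) / 2) * qPow τ (-((n : ℚ) * (n + 1) / 2)) = 1 := by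
      rw [← qPow_add, add_neg_cancel, qPow_zero]
    have hn : (-1 : ℂ) ^ n * (-1) ^ n = 1 := by rw [← mul_pow]; simp
    -- With k = j - n, the weight k splits into the differentiated sum minus n times the sum that
    -- vanishes at z = 1.
    have h2 : ∀ j ∈ Finset.range (2 * n + 2),
        -((-1) ^ (i j) * (((i j : ℤ) : ℂ) * qPow τ (((i j : ℤ) : ℚ) * ((i j : ℤ) - 1) / 2))) *
          jacobiCoeff τ n (i j) =
        -((-1) ^ n * qPow τ ((n : ℚ) * (n + 1) / 2)) *
        ((-1) ^ j * qPow τ ((j : ℚ) * (j - 1) / 2 - n * j) *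
          gaussBinomial (qPow τ 1) (2 * n + 1) j * j -
        n * ((-1) ^ j * qPow τ ((j : ℚ) * (j - 1) / 2 - n * j) *
          gaussBinomial (qPow τ 1) (2 * n + 1) j)) := by
      intro j _
      have hi : i j = (j : ℤ) - n := rfl
      have hj : jacobiCoeff τ n ((j : ℤ) - n) = gaussBinomial (qPow τ 1) (2 * n + 1) j := by
        simp [jacobiCoeff]
      rw [hi, hj, show ((((j : ℤ) - n : ℤ) : ℚ) * (((j : ℤ) - n : ℤ) - 1) / 2) =
        (n : ℚ) * (n + 1) / 2 + ((j : ℚ) * (j - 1) / 2 - n * j) by push_cast; ring, qPow_add,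
        zpow_sub₀ (by norm_num), zpow_natCast, zpow_natCast, div_eq_mul_inv, ← inv_pow]
      push_cast
      norm_num
      ring
    rw [Finset.sum_congr rfl h2, ← Finset.mul_sum, Finset.sum_sub_distrib, ← Finset.mul_sum,
      h0, h1]
    linear_combination (-(qFactorial τ n ^ 2) * (-1) ^ n * (-1) ^ n) * hq -
      qFactorial τ n ^ 2 * hn
  · intro k hk
    suffices jacobiCoeff τ n k = 0 by rw [this, mul_zero]
    unfold jacobiCoeff
    split_ifs with h
    · refine gaussBinomial_eq_zero _ ?_
      by_contra! hlt
      refine hk (Finset.mem_map.2 ⟨(k + n).toNat, Finset.mem_range.2 (by omega), ?_⟩)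
      change ((k + n).toNat : ℤ) - n = k
      omega
    · rfl

lemma jacobiCoeff_eq_div (τ : UpperHalfPlane) {n : ℕ} {k : ℤ} (h1 : 0 ≤ k + n)
    (h2 : k ≤ n + 1) : jacobiCoeff τ n k = qFactorial τ (2 * n + 1) *
      ((qFactorial τ (k + n).toNat)⁻¹ * (qFactorial τ (n + 1 - k).toNat)⁻¹) := by
  rw [jacobiCoeff, if_pos h1,
    ← gaussBinomial_mul_qFactorial τ (2 * n + 1) (k + n).toNat (n + 1 - k).toNat (by omega)]
  have := qFactorial_ne_zero τ (k + n).toNat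
  have := qFactorial_ne_zero τ (n + 1 - k).toNat
  field_simp

/-- The finite Euler products and their inverses both converge, hence are bounded. Uniformity in n
and k supplies the dominating series for the limit n → ∞. -/
lemma exists_norm_jacobiCoeff_le (τ : UpperHalfPlane) : ∃ C, ∀ n k, ‖jacobiCoeff τ n k‖ ≤ C := by
  obtain ⟨A, hA⟩ := (tendsto_qFactorial τ).norm.bddAbove_range
  obtain ⟨B, hB⟩ := ((tendsto_qFactorial τ).inv₀ (eulerJ_one_ne_zero τ)).norm.bddAbove_range
  have hA' : ∀ n, ‖qFactorial τ n‖ ≤ A := fun n => hA ⟨n, rfl⟩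
  have hB' : ∀ n, ‖(qFactorial τ n)⁻¹‖ ≤ B := fun n => hB ⟨n, rfl⟩
  have hA0 := (norm_nonneg _).trans (hA' 0)
  have hB0 := (norm_nonneg _).trans (hB' 0)
  refine ⟨A * (B * B), fun n k => ?_⟩
  by_cases h1 : 0 ≤ k + n
  · by_cases h2 : k ≤ n + 1
    · rw [jacobiCoeff_eq_div τ h1 h2, norm_mul, norm_mul]
      exact mul_le_mul (hA' _) (mul_le_mul (hB' _) (hB' _) (norm_nonneg _) hB0) (by positivity) hA0
    · rw [jacobiCoeff, if_pos h1, gaussBinomial_eq_zero _ (by omega), norm_zero]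
      positivity
  · rw [jacobiCoeff, if_neg h1, norm_zero]
    positivity

lemma tendsto_jacobiCoeff (τ : UpperHalfPlane) (k : ℤ) :
    Tendsto (fun n => jacobiCoeff τ n k) atTop (𝓝 (eulerJ 1 τ)⁻¹) := by
  have hJ := tendsto_qFactorial τ
  have h0 := eulerJ_one_ne_zero τ
  have h1 : Tendsto (fun n : ℕ => 2 * n + 1) atTop atTop :=
    tendsto_atTop_mono (fun n => by simp only [id]; omega) tendsto_id
  have h2 : Tendsto (fun n : ℕ => (k + n).toNat) atTop atTop :=
    tendsto_atTop_mono (f := fun n => n - k.natAbs) (fun n => by omega) (tendsto_sub_atTop_nat _)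
  have h3 : Tendsto (fun n : ℕ => ((n : ℤ) + 1 - k).toNat) atTop atTop :=
    tendsto_atTop_mono (f := fun n => n - k.natAbs) (fun n => by omega) (tendsto_sub_atTop_nat _)
  have h := (hJ.comp h1).mul (((hJ.comp h2).inv₀ h0).mul ((hJ.comp h3).inv₀ h0))
  rw [mul_inv_cancel_left₀ h0] at h
  refine h.congr' ?_
  filter_upwards [eventually_ge_atTop k.natAbs] with n hn
  exact (jacobiCoeff_eq_div τ (by omega) (by omega)).symm

lemma summable_jacobi_cube (τ : UpperHalfPlane) : Summable fun k : ℤ =>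
    -((-1) ^ k * (k * qPow τ ((k : ℚ) * (k - 1) / 2))) := by
  refine (summable_sign_mul norm_neg_one_zpow ?_).neg
  refine (summable_intCast_mul_qPow_quadratic τ (show (0 : ℚ) < 1 / 2 by norm_num)
    (-1 / 2) 0).congr fun k => ?_
  ring_nf

/-- **Jacobi's identity** for the cube of the Euler product, as a bilateral series. -/
lemma tsum_jacobi_cube (τ : UpperHalfPlane) :
    ∑' k : ℤ, -((-1) ^ k * (k * qPow τ ((k : ℚ) * (k - 1) / 2))) = eulerJ 1 τ ^ 3 := by
  obtain ⟨C, hC⟩ := exists_norm_jacobiCoeff_le τ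
  have hs := summable_jacobi_cube τ
  have h := tendsto_tsum_of_dominated_convergence (𝓕 := atTop)
    (f := fun (n : ℕ) (k : ℤ) =>
      -((-1) ^ k * (k * qPow τ ((k : ℚ) * (k - 1) / 2))) * jacobiCoeff τ n k)
    (hs.norm.mul_right C) (fun k => (tendsto_jacobiCoeff τ k).const_mul _)
    (.of_forall fun n k => by
      rw [norm_mul]
      exact mul_le_mul_of_nonneg_left (hC n k) (norm_nonneg _))
  simp only [← qFactorial_sq_eq_tsum] at h
  -- Each coefficient tends to 1/J₁ and the left side to J₁², so the series equals J₁³.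
  have h2 := tendsto_nhds_unique h ((tendsto_qFactorial τ).pow 2)
  rw [tsum_mul_right] at h2
  have h0 := eulerJ_one_ne_zero τ
  rw [← div_eq_mul_inv, div_eq_iff h0] at h2
  rw [h2]
  ring

/-! ### The pentagonal number theorem -/

/-- The product is at most exp(∑ |q|^i) whatever k is. This uniformity in k makes the remainder in
the pentagonal recursion tend to 0. -/
lemma exists_norm_pow_mul_prod_one_sub_pow_le {q : ℂ} (hq : ‖q‖ < 1) :
    ∃ C : ℝ, ∀ k n : ℕ,
      ‖q ^ ((k + 1) * n) * ∏ i ∈ Finset.range (n + 1), (1 - q ^ (k + i + 1))‖ ≤ C * ‖q‖ ^ n := by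
  have hs : Summable fun n : ℕ => ‖q‖ ^ n := summable_geometric_of_lt_one (norm_nonneg _) hq
  refine ⟨Real.exp (∑' n : ℕ, ‖q‖ ^ n), fun k n => ?_⟩
  rw [norm_mul, mul_comm]
  refine mul_le_mul ?_ ?_ (norm_nonneg _) (Real.exp_nonneg _)
  · calc ‖∏ i ∈ Finset.range (n + 1), (1 - q ^ (k + i + 1))‖
        ≤ ∏ i ∈ Finset.range (n + 1), ‖1 - q ^ (k + i + 1)‖ := Finset.norm_prod_le _ _
      _ ≤ ∏ i ∈ Finset.range (n + 1), Real.exp (‖q‖ ^ i) := by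
        refine Finset.prod_le_prod (fun _ _ => norm_nonneg _) fun i _ => ?_
        calc ‖1 - q ^ (k + i + 1)‖ ≤ 1 + ‖q‖ ^ (k + i + 1) := by
              simpa using norm_sub_le (1 : ℂ) (q ^ (k + i + 1))
          _ ≤ ‖q‖ ^ i + 1 := by
              have := pow_le_pow_of_le_one (norm_nonneg q) hq.le (show i ≤ k + i + 1 by omega)
              linarith
          _ ≤ _ := Real.add_one_le_exp _
      _ = Real.exp (∑ i ∈ Finset.range (n + 1), ‖q‖ ^ i) := (Real.exp_sum _ _).symm
      _ ≤ _ := Real.exp_le_exp.2 (hs.sum_le_tsum _ fun _ _ => by positivity)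
  · rw [norm_pow]
    exact pow_le_pow_of_le_one (norm_nonneg q) hq.le (by nlinarith)

/-- **Pentagonal number theorem** on the complex unit disc. -/
lemma tprod_one_sub_pow_eq_tsum_pentagonal {q : ℂ} (hq : ‖q‖ < 1) :
    ∏' n : ℕ, (1 - q ^ (n + 1)) =
      ∑' k : ℕ, (-1) ^ k * (q ^ pentagonal (-k) - q ^ pentagonal (k + 1)) := by
  obtain ⟨C, hC⟩ := exists_norm_pow_mul_prod_one_sub_pow_le hq
  have hs : Summable fun n : ℕ => ‖q‖ ^ n := summable_geometric_of_lt_one (norm_nonneg _) hq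
  have hp : Summable fun k : ℤ => q ^ pentagonal k := by
    refine (Summable.of_norm ?_ : Summable fun n : ℕ => q ^ n).comp_injective pentagonal_injective
    simpa using hs
  refine Pentagonal.tprod_one_sub_pow (tendsto_pow_atTop_nhds_zero_of_norm_lt_one hq)
    (fun k => .of_norm_bounded (hs.mul_left C) (hC k)) (fun k => ?_) ?_ ?_
  · apply multipliable_one_add_of_summable (f := fun n ↦ -q ^ (n + k + 1))
    simpa [add_assoc] using (summable_nat_add_iff (k + 1)).mpr hs
  · refine summable_sign_mul (by simp) (Summable.sub ?_ ?_)
    · exact hp.comp_injective (i := fun k : ℕ => -(k : ℤ)) fun a b h => by simpa using h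
    · exact hp.comp_injective (i := fun k : ℕ => (k : ℤ) + 1) fun a b h => by simpa using h
  · have hb : ∀ k : ℕ, ‖(-1) ^ (k + 1) * q ^ ((k + 1) * (3 * k + 4) / 2) *
        ∑' (n : ℕ), q ^ ((k + 1) * n) * ∏ i ∈ Finset.range (n + 1), (1 - q ^ (k + i + 1))‖ ≤
        ‖q‖ ^ k * ∑' n : ℕ, C * ‖q‖ ^ n := by
      intro k
      rw [norm_mul, norm_mul]
      refine mul_le_mul ?_ (tsum_of_norm_bounded (hs.mul_left C).hasSum (hC k))
        (norm_nonneg _) (by positivity)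
      simp only [norm_pow, norm_neg, norm_one, one_pow, one_mul]
      refine pow_le_pow_of_le_one (norm_nonneg q) hq.le ?_
      rw [Nat.le_div_iff_mul_le two_pos]
      nlinarith
    refine squeeze_zero_norm hb ?_
    simpa using (tendsto_pow_atTop_nhds_zero_of_lt_one (norm_nonneg q) hq).mul_const _

/-- The pentagonal number theorem as a bilateral series. -/
lemma tsum_pentagonal (τ : UpperHalfPlane) :
    ∑' k : ℤ, (-1 : ℂ) ^ k * qPow τ ((3 * (k : ℚ) ^ 2 - k) / 2) = eulerJ 1 τ := by
  have hpent : ∀ k : ℤ, qPow τ ((3 * (k : ℚ) ^ 2 - k) / 2) = qPow τ 1 ^ pentagonal k := by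
    intro k
    rw [← qPow_nsmul]
    congr 1
    have : (2 * (pentagonal k : ℤ) : ℚ) = k * (3 * k - 1) := by
      exact_mod_cast two_mul_natCast_pentagonal k
    push_cast at this
    linear_combination (-1 / 2 : ℚ) * this
  have hs : Summable fun k : ℤ => (-1 : ℂ) ^ k * qPow τ ((3 * (k : ℚ) ^ 2 - k) / 2) := by
    refine summable_sign_mul norm_neg_one_zpow ?_
    refine (summable_qPow_quadratic τ (show (0 : ℚ) < 3 / 2 by norm_num) (-1 / 2) 0).congr ?_
    intro k
    ring_nf
  -- After k ↦ -k, pairing n with -(n+1) matches the exponents `pentagonal (-n)` and `pentagonal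
  -- (n+1)`.
  have hs' := (Equiv.neg ℤ).summable_iff.2 hs
  rw [← (Equiv.neg ℤ).tsum_eq, eulerJ_one,
    tprod_one_sub_pow_eq_tsum_pentagonal (norm_qPow_one_lt τ)]
  refine (tsum_nat_add_neg_add_one hs').symm.trans ?_
  congr 1
  ext k
  simp only [Function.comp_apply, Equiv.neg_apply, hpent, neg_neg]
  rw [zpow_neg, zpow_add₀ (by norm_num), zpow_natCast, ← inv_pow]
  norm_num
  ring

lemma tsum_pentagonal_neg (τ : UpperHalfPlane) :
    ∑' k : ℤ, (-1 : ℂ) ^ k * qPow τ ((3 * (k : ℚ) ^ 2 + k) / 2) = eulerJ 1 τ := by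
  rw [← tsum_pentagonal, ← (Equiv.neg ℤ).tsum_eq]
  congr 1
  ext k
  simp only [Equiv.neg_apply, zpow_neg, ← inv_zpow]
  norm_num [sub_eq_add_neg]

/-! ### Partial theta series -/

/-- The terms of the partial theta series `∑_{i ≥ 0} (-1)^i q^{i(i+1)/2 + i n}`. -/
noncomputable def partialThetaTerm (τ : UpperHalfPlane) (n : ℤ) (i : ℕ) : ℂ :=
  (-1) ^ i * qPow τ ((i : ℚ) * (i + 1) / 2 + i * n)

/-- The partial theta series `∑_{i ≥ 0} (-1)^i q^{i(i+1)/2 + i n}`. -/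
noncomputable def partialTheta (τ : UpperHalfPlane) (n : ℤ) : ℂ :=
  ∑' i : ℕ, partialThetaTerm τ n i

lemma summable_partialThetaTerm (τ : UpperHalfPlane) (n : ℤ) :
    Summable (partialThetaTerm τ n) := by
  refine summable_sign_mul (by simp) ?_
  refine ((summable_qPow_quadratic τ (show (0 : ℚ) < 1 / 2 by norm_num)
    (1 / 2 + n) 0).comp_injective (Nat.cast_injective (R := ℤ))).congr fun i => ?_
  simp only [Function.comp_apply, Int.cast_natCast]
  ring_nf

lemma partialTheta_eq_one_sub (τ : UpperHalfPlane) (n : ℤ) :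
    partialTheta τ n = 1 - qPow τ (n + 1) * partialTheta τ (n + 1) := by
  have h : ∀ i, partialThetaTerm τ n (i + 1) =
      -(qPow τ (n + 1) * partialThetaTerm τ (n + 1) i) := by
    intro i
    have : qPow τ (((i + 1 : ℕ) : ℚ) * ((i + 1 : ℕ) + 1) / 2 + (i + 1 : ℕ) * n) =
        qPow τ (n + 1) * qPow τ ((i : ℚ) * (i + 1) / 2 + i * (n + 1 : ℤ)) := by
      rw [← qPow_add]; congr 1; push_cast; ring
    rw [partialThetaTerm, partialThetaTerm, this]
    ring
  rw [partialTheta, (summable_partialThetaTerm τ n).tsum_eq_zero_add]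
  simp only [h, tsum_neg, tsum_mul_left]
  simp [partialThetaTerm, partialTheta, qPow_zero, sub_eq_add_neg]

/-- The recurrences at n and at -(n+1) propagate the symmetry from n to n+1. It controls the series
at negative arguments, where individual terms can be large. -/
lemma partialTheta_neg (τ : UpperHalfPlane) (n : ℕ) :
    partialTheta τ (-n) = qPow τ n * partialTheta τ n := by
  induction n with
  | zero => simp [qPow_zero]
  | succ n ih =>
    have h1 := partialTheta_eq_one_sub τ n
    have h2 := partialTheta_eq_one_sub τ (-(n + 1 : ℕ))
    rw [show (-((n + 1 : ℕ) : ℤ) + 1) = -n by push_cast; ring, ih,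
      show (((-(n + 1 : ℕ) : ℤ) : ℚ) + 1) = -n by push_cast; ring, ← mul_assoc, ← qPow_add,
      neg_add_cancel, qPow_zero] at h2
    push_cast at h1 h2 ⊢
    linear_combination h2 - h1

/-- Termwise comparison with n = 0 settles n ≥ 0, and the reflection settles n < 0. Boundedness is
what makes the sums over j, and the rearrangements below, absolutely convergent once i has been
summed. -/
lemma exists_norm_partialTheta_le (τ : UpperHalfPlane) : ∃ C, ∀ n, ‖partialTheta τ n‖ ≤ C := by
  have hs := (summable_partialThetaTerm τ 0).norm
  have hnat : ∀ n : ℕ, ‖partialTheta τ n‖ ≤ ∑' i, ‖partialThetaTerm τ 0 i‖ := by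
    intro n
    refine tsum_of_norm_bounded hs.hasSum fun i => ?_
    simp only [partialThetaTerm, qPow_add, norm_mul, norm_pow, norm_neg, norm_one, one_pow,
      one_mul, Int.cast_zero, mul_zero, qPow_zero]
    refine mul_le_mul_of_nonneg_left (norm_qPow_le_one τ (by push_cast; positivity))
      (norm_nonneg _)
  refine ⟨∑' i, ‖partialThetaTerm τ 0 i‖, fun n => ?_⟩
  rcases n.eq_nat_or_neg with ⟨n, rfl | rfl⟩
  · exact hnat n
  · rw [partialTheta_neg, norm_mul]
    exact (mul_le_of_le_one_left (norm_nonneg _) (norm_qPow_le_one τ (by positivity))).trans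
      (hnat n)

lemma summable_mul_partialTheta (τ : UpperHalfPlane) {ι : Type*} {g : ι → ℂ} (hg : Summable g)
    (a : ι → ℤ) : Summable fun i => g i * partialTheta τ (a i) := by
  obtain ⟨C, hC⟩ := exists_norm_partialTheta_le τ
  refine .of_norm_bounded (hg.norm.mul_right C) fun i => ?_
  rw [norm_mul]
  exact mul_le_mul_of_nonneg_left (hC _) (norm_nonneg _)

/-! ### Partial theta series as coefficients of the reciprocal theta function -/

/-- The coefficients `(-1)^k q^{k(k-1)/2}` of the theta function. -/
noncomputable def thetaCoeff (τ : UpperHalfPlane) (k : ℤ) : ℂ :=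
  (-1) ^ k * qPow τ ((k : ℚ) * (k - 1) / 2)

lemma summable_thetaCoeff (τ : UpperHalfPlane) : Summable (thetaCoeff τ) := by
  refine summable_sign_mul norm_neg_one_zpow ?_
  refine (summable_qPow_quadratic τ (show (0 : ℚ) < 1 / 2 by norm_num) (-1 / 2) 0).congr
    fun k => ?_
  ring_nf

lemma neg_one_zpow_add_one (k : ℤ) : (-1 : ℂ) ^ (k + 1) = -(-1) ^ k := by
  rw [zpow_add₀ (by norm_num)]; simp

lemma neg_one_zpow_odd_sub (c k : ℤ) : (-1 : ℂ) ^ (2 * c + 1 - k) = -(-1) ^ k := by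
  rw [zpow_sub₀ (by norm_num), neg_one_zpow_add_one, zpow_mul, div_eq_mul_inv, ← inv_zpow]
  norm_num

lemma tsum_thetaCoeff (τ : UpperHalfPlane) : ∑' k, thetaCoeff τ k = 0 := by
  refine tsum_eq_zero_of_reflection 1 fun k => ?_
  have h := neg_one_zpow_odd_sub 0 k
  rw [mul_zero, zero_add] at h
  rw [thetaCoeff, h, thetaCoeff, neg_mul]
  congr 3
  push_cast
  ring

/-- The Laurent coefficients of the product of the theta function and the generating function of
the partial theta series. -/
noncomputable def thetaConvolution (τ : UpperHalfPlane) (n : ℤ) : ℂ :=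
  ∑' k, thetaCoeff τ k * partialTheta τ (n - k)

/-- Shifting k by one and applying the recurrence for P shows that the convolution W satisfies W(n)
= θ(1) + q^n W(n). Since θ(1) = 0 and q^n ≠ 1, it vanishes. -/
lemma thetaConvolution_eq_zero (τ : UpperHalfPlane) {n : ℤ} (hn : n ≠ 0) :
    thetaConvolution τ n = 0 := by
  have hw := summable_mul_partialTheta τ (summable_thetaCoeff τ) (fun k => n - k)
  have hstep : ∀ k, thetaCoeff τ (k + 1) * partialTheta τ (n - (k + 1)) =
      thetaCoeff τ (k + 1) + qPow τ n * (thetaCoeff τ k * partialTheta τ (n - k)) := by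
    intro k
    have h1 : thetaCoeff τ (k + 1) * qPow τ ((n - (k + 1) : ℤ) + 1) =
        -(qPow τ n * thetaCoeff τ k) := by
      have : qPow τ (((k + 1 : ℤ) : ℚ) * ((k + 1 : ℤ) - 1) / 2) *
          qPow τ ((n - (k + 1) : ℤ) + 1) = qPow τ n * qPow τ ((k : ℚ) * (k - 1) / 2) := by
        rw [← qPow_add, ← qPow_add]; congr 1; push_cast; ring
      rw [thetaCoeff, thetaCoeff, neg_one_zpow_add_one]
      linear_combination (-(-1) ^ k) * this
    rw [partialTheta_eq_one_sub, show n - (k + 1) + 1 = n - k by ring]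
    linear_combination (-partialTheta τ (n - k)) * h1
  have h1 := (Equiv.addRight (1 : ℤ)).tsum_eq fun k => thetaCoeff τ k * partialTheta τ (n - k)
  have h2 := (Equiv.addRight (1 : ℤ)).tsum_eq (thetaCoeff τ)
  have hs : Summable fun k => thetaCoeff τ (k + 1) :=
    (Equiv.addRight (1 : ℤ)).summable_iff.2 (summable_thetaCoeff τ)
  simp only [Equiv.coe_addRight, hstep] at h1 h2
  rw [Summable.tsum_add hs (hw.mul_left _), h2, tsum_thetaCoeff, zero_add, tsum_mul_left] at h1
  have h3 : (1 - qPow τ n) * thetaConvolution τ n = 0 := by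
    rw [thetaConvolution]
    linear_combination -h1
  exact (mul_eq_zero.1 h3).resolve_left
    (sub_ne_zero.2 (qPow_ne_one τ (by exact_mod_cast hn)).symm)

/-- Summation of a doubly indexed family depending on the sum of its indices only. -/
lemma hasSum_tsum_add {u : ℕ → ℂ} (hu : Summable fun n : ℕ => ((n : ℂ) + 1) * u n) :
    HasSum (fun n : ℕ => ∑' i : ℕ, u (n + i)) (∑' n : ℕ, ((n : ℂ) + 1) * u n) := by
  set e := Finset.HasAntidiagonal.sigmaAntidiagonalEquivProd (A := ℕ)
  have hval : ∀ x : Σ n : ℕ, Finset.HasAntidiagonal.antidiagonal n,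
      u ((e x).1 + (e x).2) = u x.1 := by
    rintro ⟨n, x, hx⟩
    rw [Finset.HasAntidiagonal.mem_antidiagonal] at hx
    change u (x.1 + x.2) = u n
    rw [hx]
  have hcard : ∀ (n : ℕ) (c : ℂ),
      ∑' _ : Finset.HasAntidiagonal.antidiagonal n, c = ((n : ℂ) + 1) * c := by
    intro n c
    simp [tsum_fintype]
  have hsig : Summable fun x : Σ n : ℕ, Finset.HasAntidiagonal.antidiagonal n => u x.1 := by
    refine .of_norm ((summable_sigma_of_nonneg fun _ => norm_nonneg _).2 ⟨fun n => ?_, ?_⟩)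
    · exact (hasSum_fintype _).summable
    · refine hu.norm.congr fun n => ?_
      rw [tsum_fintype, norm_mul, show ((n : ℂ) + 1) = ((n + 1 : ℕ) : ℂ) by push_cast; rfl,
        Complex.norm_natCast]
      simp
  have hF : Summable fun x : ℕ × ℕ => u (x.1 + x.2) := by
    rw [← e.summable_iff]
    exact hsig.congr fun x => (hval x).symm
  have h1 : ∑' n : ℕ, ((n : ℂ) + 1) * u n = ∑' n, ∑' i, u (n + i) := by
    rw [← hF.tsum_prod, ← e.tsum_eq]
    simp only [hval]
    rw [hsig.tsum_sigma]
    simp only [hcard]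
  rw [h1]
  exact hF.prod.hasSum

lemma thetaCoeff_neg_natCast (τ : UpperHalfPlane) (n : ℕ) :
    thetaCoeff τ (-n) = (-1) ^ n * qPow τ ((n : ℚ) * (n + 1) / 2) := by
  rw [thetaCoeff, zpow_neg, zpow_natCast, ← inv_pow]
  congr 2
  · norm_num
  · push_cast; ring

lemma thetaCoeff_natCast_add_one (τ : UpperHalfPlane) (n : ℕ) :
    thetaCoeff τ (n + 1) = -((-1) ^ n * qPow τ ((n : ℚ) * (n + 1) / 2)) := by
  rw [thetaCoeff, neg_one_zpow_add_one, zpow_natCast, neg_mul]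
  congr 3
  push_cast
  ring

lemma qPow_mul_partialTheta (τ : UpperHalfPlane) (n : ℕ) :
    (-1) ^ n * qPow τ ((n : ℚ) * (n + 1) / 2) * partialTheta τ n =
      ∑' i : ℕ, (-1) ^ (n + i) * qPow τ (((n + i : ℕ) : ℚ) * ((n + i : ℕ) + 1) / 2) := by
  rw [partialTheta, ← tsum_mul_left]
  congr 1
  ext i
  have : qPow τ (((n + i : ℕ) : ℚ) * ((n + i : ℕ) + 1) / 2) =
      qPow τ ((n : ℚ) * (n + 1) / 2) * qPow τ ((i : ℚ) * (i + 1) / 2 + i * (n : ℤ)) := by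
    rw [← qPow_add]; congr 1; push_cast; ring
  rw [this, partialThetaTerm, pow_add]
  ring

/-- With u(n) = (-1)^n q^{n(n+1)/2}, the indices k = -n and k = n+1 contribute the tails of ∑ u from
n and from n+1. Summing over n counts u(n) with weight (n+1) + n, which is Jacobi's series. -/
lemma thetaConvolution_zero (τ : UpperHalfPlane) : thetaConvolution τ 0 = eulerJ 1 τ ^ 3 := by
  set u : ℕ → ℂ := fun n => (-1) ^ n * qPow τ ((n : ℚ) * (n + 1) / 2) with hu
  have hcast : Function.Injective (Nat.cast : ℕ → ℤ) := Nat.cast_injective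
  have hu0 : Summable u := by
    refine (summable_partialThetaTerm τ 0).congr fun n => ?_
    simp [partialThetaTerm, hu]
  have hu1 : Summable fun n : ℕ => (n : ℂ) * u n := by
    have h := (summable_intCast_mul_qPow_quadratic τ (show (0 : ℚ) < 1 / 2 by norm_num)
      (1 / 2) 0).comp_injective hcast
    refine (summable_sign_mul (s := fun n : ℕ => (-1 : ℂ) ^ n) (by simp) h).congr fun n => ?_
    simp only [hu, Function.comp_apply, Int.cast_natCast]
    rw [mul_left_comm]
    ring_nf
  have hu2 : Summable fun n : ℕ => ((n : ℂ) + 1) * u n := by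
    simpa only [add_mul, one_mul] using hu1.add hu0
  have hu3 : Summable fun n : ℕ => ((n : ℂ) + 1) * u (n + 1) := by
    simpa using (summable_nat_add_iff 1).2 hu1
  have hu4 : ∑' n : ℕ, ((n : ℂ) + 1) * u (n + 1) = ∑' n : ℕ, (n : ℂ) * u n := by
    rw [hu1.tsum_eq_zero_add]
    simp
  have hA := hasSum_tsum_add hu2
  have hB := hasSum_tsum_add hu3
  have hw := (Equiv.neg ℤ).summable_iff.2
    (summable_mul_partialTheta τ (summable_thetaCoeff τ) (fun k => 0 - k))
  rw [thetaConvolution, ← (Equiv.neg ℤ).tsum_eq]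
  refine (tsum_nat_add_neg_add_one hw).symm.trans ?_
  have hterm : ∀ n : ℕ, thetaCoeff τ (-n) * partialTheta τ (0 - -n) +
      thetaCoeff τ (- -((n : ℤ) + 1)) * partialTheta τ (0 - - -((n : ℤ) + 1)) =
      ∑' i : ℕ, u (n + i) + ∑' i : ℕ, u (n + i + 1) := by
    intro n
    have h1 := qPow_mul_partialTheta τ n
    have h2 := qPow_mul_partialTheta τ (n + 1)
    have h3 := partialTheta_neg τ (n + 1)
    have h4 : qPow τ (((n + 1 : ℕ) : ℚ) * ((n + 1 : ℕ) + 1) / 2) =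
        qPow τ ((n : ℚ) * (n + 1) / 2) * qPow τ (n + 1 : ℕ) := by
      rw [← qPow_add]; congr 1; push_cast; ring
    have h5 : ∑' i : ℕ, u (n + i + 1) = ∑' i : ℕ, u (n + 1 + i) := by
      congr 1; ext i; congr 1; ring
    rw [h5]
    change _ = ∑' i : ℕ, (-1) ^ (n + i) * qPow τ (((n + i : ℕ) : ℚ) * ((n + i : ℕ) + 1) / 2) +
      ∑' i : ℕ, (-1) ^ (n + 1 + i) *
        qPow τ (((n + 1 + i : ℕ) : ℚ) * ((n + 1 + i : ℕ) + 1) / 2)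
    rw [← h1, ← h2, h4, thetaCoeff_neg_natCast, neg_neg, thetaCoeff_natCast_add_one,
      zero_sub, zero_sub, neg_neg, show (-((n : ℤ) + 1)) = -((n + 1 : ℕ) : ℤ) by push_cast; rfl,
      h3]
    ring
  -- The shift pairs the Jacobi terms at n+1 and -n, which contribute (n+1) u(n) and n u(n).
  have hJ := (Equiv.addRight (1 : ℤ)).tsum_eq
    fun k : ℤ => -((-1) ^ k * (k * qPow τ ((k : ℚ) * (k - 1) / 2)))
  have hJs := (Equiv.addRight (1 : ℤ)).summable_iff.2 (summable_jacobi_cube τ)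
  rw [← tsum_jacobi_cube, ← hJ]
  refine Eq.trans ?_ (tsum_nat_add_neg_add_one hJs)
  simp only [Function.comp_apply, Equiv.neg_apply, Equiv.coe_addRight]
  rw [tsum_congr hterm, (hA.add hB).tsum_eq, hu4, ← hu2.tsum_add hu1]
  congr 1
  ext n
  have h1 := thetaCoeff_natCast_add_one τ n
  have h2 := thetaCoeff_neg_natCast τ n
  rw [thetaCoeff] at h1 h2
  rw [show -((n : ℤ) + 1) + 1 = -n by ring]
  push_cast at h1 h2 ⊢
  simp only [hu]
  linear_combination ((n : ℂ) + 1) * h1 - (n : ℂ) * h2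

/-! ### Products of two theta functions -/

/-- The terms `(-1)^k q^{k(k-1)/2 + (n-k)^2 + (n-k)ℓ}`, whose sum over `k` is a Laurent coefficient
of the product of two theta functions. -/
noncomputable def thetaProductTerm (τ : UpperHalfPlane) (ℓ n k : ℤ) : ℂ :=
  thetaCoeff τ k * qPow τ (((n : ℚ) - k) ^ 2 + (n - k) * ℓ)

/-- The Laurent coefficients of the product of two theta functions. -/
noncomputable def thetaProductCoeff (τ : UpperHalfPlane) (ℓ n : ℤ) : ℂ :=
  ∑' k, thetaProductTerm τ ℓ n k

/-- Summation of a doubly indexed family along the lines on which the sum of the indices is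
constant. -/
lemma hasSum_tsum_sub {F : ℤ × ℤ → ℂ} (hF : Summable F) :
    HasSum (fun n => ∑' k, F (n - k, k)) (∑' n, ∑' k, F (n, k)) := by
  let e : ℤ × ℤ ≃ ℤ × ℤ :=
    ⟨fun x => (x.1 - x.2, x.2), fun x => (x.1 + x.2, x.2), fun x => by simp, fun x => by simp⟩
  have hFe : Summable fun x => F (e x) := e.summable_iff.2 hF
  rw [← hF.tsum_prod, ← e.tsum_eq F, hFe.tsum_prod]
  exact hFe.prod.hasSum

/-- Associativity of convolution: (θ * φ) * P = φ * (θ * P), and θ * P is J₁³ times the unit at 0.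
Boundedness of P justifies the rearrangement. -/
lemma hasSum_tsum_mul_thetaCoeff_mul_partialTheta (τ : UpperHalfPlane) {φ : ℤ → ℂ}
    (hφ : Summable φ) (p : ℤ) :
    HasSum (fun n => (∑' k, thetaCoeff τ k * φ (n - k)) * partialTheta τ (p - n))
      (φ p * eulerJ 1 τ ^ 3) := by
  have hφt : Summable fun x : ℤ × ℤ => φ x.1 * thetaCoeff τ x.2 :=
    summable_mul_of_summable_norm hφ.norm (summable_thetaCoeff τ).norm
  have h := hasSum_tsum_sub (summable_mul_partialTheta τ hφt fun x => p - x.1 - x.2)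
  have h1 : ∀ n : ℤ, ∑' k : ℤ, φ n * thetaCoeff τ k * partialTheta τ (p - n - k) =
      φ n * thetaConvolution τ (p - n) := by
    intro n
    simp only [mul_assoc, tsum_mul_left, thetaConvolution]
  have h2 : ∀ n : ℤ, ∑' k : ℤ, φ (n - k) * thetaCoeff τ k * partialTheta τ (p - (n - k) - k) =
      (∑' k, thetaCoeff τ k * φ (n - k)) * partialTheta τ (p - n) := by
    intro n
    rw [← tsum_mul_right]
    refine tsum_congr fun k => ?_
    rw [show p - (n - k) - k = p - n by ring, mul_comm (φ _)]
  have h3 : ∑' n : ℤ, φ n * thetaConvolution τ (p - n) = φ p * eulerJ 1 τ ^ 3 := by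
    rw [tsum_eq_single p]
    · rw [sub_self, thetaConvolution_zero]
    · intro n hn
      rw [thetaConvolution_eq_zero τ (sub_ne_zero.2 hn.symm), mul_zero]
  simp only [h1, h2, h3] at h
  exact h

lemma hasSum_thetaProductCoeff_mul_partialTheta (τ : UpperHalfPlane) (ℓ p : ℤ) :
    HasSum (fun n => thetaProductCoeff τ ℓ n * partialTheta τ (p - n))
      (qPow τ ((p : ℚ) ^ 2 + p * ℓ) * eulerJ 1 τ ^ 3) := by
  have hφ : Summable fun n : ℤ => qPow τ ((n : ℚ) ^ 2 + n * ℓ) := by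
    refine (summable_qPow_quadratic τ (show (0 : ℚ) < 1 by norm_num) ℓ 0).congr fun k => ?_
    ring_nf
  have h := hasSum_tsum_mul_thetaCoeff_mul_partialTheta τ hφ p
  simp only [Int.cast_sub] at h
  exact h

lemma tsum_pentagonal_of_eq_zero_or_one (τ : UpperHalfPlane) {ℓ : ℤ} (hℓ : ℓ = 0 ∨ ℓ = 1) :
    ∑' k : ℤ, (-1 : ℂ) ^ k * qPow τ (3 / 2 * (k : ℚ) ^ 2 + k * (ℓ - 1 / 2)) = eulerJ 1 τ := by
  rcases hℓ with rfl | rfl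
  · rw [← tsum_pentagonal]
    refine tsum_congr fun k => ?_
    congr 2
    push_cast
    ring
  · rw [← tsum_pentagonal_neg]
    refine tsum_congr fun k => ?_
    congr 2
    push_cast
    ring

lemma tsum_pentagonal_of_eq_zero_or_one_neg (τ : UpperHalfPlane) {ℓ : ℤ} (hℓ : ℓ = 0 ∨ ℓ = 1) :
    ∑' k : ℤ, (-1 : ℂ) ^ k * qPow τ (3 / 2 * (k : ℚ) ^ 2 + k * (1 / 2 - ℓ)) = eulerJ 1 τ := by
  rcases hℓ with rfl | rfl
  · rw [← tsum_pentagonal_neg]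
    refine tsum_congr fun k => ?_
    congr 2
    push_cast
    ring
  · rw [← tsum_pentagonal]
    refine tsum_congr fun k => ?_
    congr 2
    push_cast
    ring

lemma thetaProductCoeff_neg (τ : UpperHalfPlane) {ℓ : ℤ} (hℓ : ℓ = 0 ∨ ℓ = 1) (j : ℤ) :
    thetaProductCoeff τ ℓ (-(3 * j) - ℓ) =
      eulerJ 1 τ * qPow τ (3 * (j : ℚ) ^ 2 + (ℓ + 1) * j) := by
  -- As a function of k the exponent is 3k²/2 - (2n + ℓ + 1/2)k + const; for n = -3j - ℓ this shift
  -- removes j from the linear coefficient.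
  rw [thetaProductCoeff, ← (Equiv.addRight (-(2 * j))).tsum_eq,
    ← tsum_pentagonal_of_eq_zero_or_one τ hℓ, ← tsum_mul_right]
  congr 1
  ext k
  rw [Equiv.coe_addRight, thetaProductTerm, thetaCoeff, mul_assoc, mul_assoc, ← qPow_add,
    ← qPow_add]
  congr 1
  · rw [zpow_add₀ (by norm_num), zpow_neg, zpow_mul]; norm_num
  · congr 1; push_cast; ring

lemma thetaProductCoeff_three_mul_add_one (τ : UpperHalfPlane) {ℓ : ℤ} (hℓ : ℓ = 0 ∨ ℓ = 1)
    (j : ℤ) : thetaProductCoeff τ ℓ (3 * j + 1) =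
      -(eulerJ 1 τ * qPow τ (3 * (j : ℚ) ^ 2 + (ℓ + 1) * j)) := by
  -- Again the shift removes j from the linear coefficient; here it is odd, which produces the minus
  -- sign.
  rw [thetaProductCoeff, ← (Equiv.addRight (2 * j + 1)).tsum_eq,
    ← tsum_pentagonal_of_eq_zero_or_one_neg τ hℓ, ← tsum_mul_right, ← tsum_neg]
  congr 1
  ext k
  rw [Equiv.coe_addRight, thetaProductTerm, thetaCoeff, mul_assoc, mul_assoc, ← qPow_add,
    ← qPow_add, ← neg_mul]
  congr 1
  · beta_reduce
    rw [← add_assoc, neg_one_zpow_add_one, zpow_add₀ (by norm_num), zpow_mul]; norm_num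
  · congr 1; push_cast; ring

lemma thetaProductCoeff_eq_zero (τ : UpperHalfPlane) (ℓ j : ℤ) :
    thetaProductCoeff τ ℓ (3 * j + 2 + ℓ) = 0 := by
  -- The constant is twice the vertex of the quadratic exponent in k. Being odd, it reverses the
  -- sign (-1)^k.
  refine tsum_eq_zero_of_reflection (2 * (2 * j + 1 + ℓ) + 1) fun k => ?_
  rw [thetaProductTerm, thetaProductTerm, thetaCoeff, thetaCoeff, neg_one_zpow_odd_sub, mul_assoc,
    mul_assoc, ← qPow_add, ← qPow_add, neg_mul]
  congr 3
  push_cast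
  ring

/-! ### Splitting modulo 3 and the string series -/

/-- A series over the integers, split according to residues modulo `3`. -/
lemma tsum_int_mod_three {g : ℤ → ℂ} (hg : Summable g) :
    ∑' n, g n = ∑' j, g (3 * j) + ∑' j, g (3 * j + 1) + ∑' j, g (3 * j + 2) := by
  have hinj : ∀ r : ℤ, Function.Injective fun j : ℤ => 3 * j + r := fun r a b h => by
    simpa using h
  have hs : ∀ r : ℤ, Summable fun j : ℤ => g (3 * j + r) := fun r => hg.comp_injective (hinj r)
  have h := (Int.divModEquiv 3).symm.tsum_eq g
  have hsum := (Int.divModEquiv 3).symm.summable_iff.2 hg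
  have h0 := hs 0
  simp only [add_zero] at h0
  rw [← h, ← h0.tsum_add (hs 1), ← (h0.add (hs 1)).tsum_add (hs 2)]
  refine (hsum.tsum_prod).trans ?_
  congr 1
  ext j
  simp [tsum_fintype, Fin.sum_univ_three, mul_comm]

/-- The sum over `ℤ` of a summable function vanishing at `3 j + 2 + ℓ`. -/
lemma tsum_eq_tsum_add_of_eq_zero_or_one {g : ℤ → ℂ} (hg : Summable g) {ℓ : ℤ}
    (hℓ : ℓ = 0 ∨ ℓ = 1) (h : ∀ j, g (3 * j + 2 + ℓ) = 0) :
    ∑' n, g n = ∑' j, (g (-(3 * j) - ℓ) + g (3 * j + 1)) := by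
  have h1 : Summable fun j => g (-(3 * j) - ℓ) :=
    hg.comp_injective (i := fun j : ℤ => -(3 * j) - ℓ) fun a b h => by simpa using h
  have h2 : Summable fun j => g (3 * j + 1) :=
    hg.comp_injective (i := fun j : ℤ => 3 * j + 1) fun a b h => by simpa using h
  rw [h1.tsum_add h2, tsum_int_mod_three hg]
  rcases hℓ with rfl | rfl
  · simp only [add_zero, sub_zero] at h ⊢
    rw [← (Equiv.neg ℤ).tsum_eq fun j => g (3 * j)]
    simp [h]
  · have h0 : ∀ j, g (3 * j) = 0 := fun j => by
      rw [← h (j - 1)]; congr 1; ring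
    -- For ℓ = 1 the class -(3j) - ℓ is 2 mod 3, reparametrized by j ↦ -1 - j.
    rw [← (Equiv.subLeft (-1 : ℤ)).tsum_eq fun j => g (3 * j + 2)]
    simp only [h0, tsum_zero, zero_add, Equiv.subLeft_apply]
    rw [add_comm]
    congr 3
    ext j
    congr 1
    ring

lemma stringTerm_one (τ : UpperHalfPlane) (ℓ p j : ℤ) (i : ℕ) :
    stringTerm 1 (2 * p + ℓ) ℓ τ j i = qPow τ (3 * (j : ℚ) ^ 2 + (ℓ + 1) * j) *
      (partialThetaTerm τ (p - (-(3 * j) - ℓ)) i - partialThetaTerm τ (p - (3 * j + 1)) i) := by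
  rw [stringTerm, partialThetaTerm, partialThetaTerm, mul_assoc, mul_sub (qPow τ _), ← qPow_add,
    ← qPow_add, ← mul_sub ((-1) ^ i), mul_left_comm, mul_sub (qPow τ _), ← qPow_add, ← qPow_add]
  congr 2
  · congr 1; push_cast; ring
  · congr 1; push_cast; ring

lemma tsum_stringTerm_one (τ : UpperHalfPlane) (ℓ p j : ℤ) :
    ∑' i, stringTerm 1 (2 * p + ℓ) ℓ τ j i = qPow τ (3 * (j : ℚ) ^ 2 + (ℓ + 1) * j) *
      (partialTheta τ (p - (-(3 * j) - ℓ)) - partialTheta τ (p - (3 * j + 1))) := by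
  simp only [stringTerm_one]
  rw [tsum_mul_left, Summable.tsum_sub (summable_partialThetaTerm τ _)
    (summable_partialThetaTerm τ _), partialTheta, partialTheta]

/-- The terms n = -3j - ℓ and n = 3j + 1 of ∑ D(n) P(p-n) have opposite coefficients and together
form J₁ times the j-th inner string sum; the third class drops out. -/
lemma eulerJ_mul_tsum_stringTerm (τ : UpperHalfPlane) {ℓ : ℤ} (hℓ : ℓ = 0 ∨ ℓ = 1) (p : ℤ) :
    eulerJ 1 τ * ∑' j, ∑' i, stringTerm 1 (2 * p + ℓ) ℓ τ j i =
      qPow τ ((p : ℚ) ^ 2 + p * ℓ) * eulerJ 1 τ ^ 3 := by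
  have h := hasSum_thetaProductCoeff_mul_partialTheta τ ℓ p
  rw [← h.tsum_eq, tsum_eq_tsum_add_of_eq_zero_or_one h.summable hℓ fun j => by
    rw [thetaProductCoeff_eq_zero, zero_mul], ← tsum_mul_left]
  congr 1
  ext j
  rw [thetaProductCoeff_neg τ hℓ, thetaProductCoeff_three_mul_add_one τ hℓ, tsum_stringTerm_one]
  ring

end StringFunction

open StringFunction in
theorem theorem2p4 (τ : UpperHalfPlane) (ℓ m : ℤ) (hℓ : ℓ = 0 ∨ ℓ = 1) (hm : m ≡ ℓ [ZMOD 2]) :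
    (∀ j : ℤ, Summable fun i : ℕ => stringTerm 1 m ℓ τ j i) ∧
    (Summable fun j : ℤ => ∑' i : ℕ, stringTerm 1 m ℓ τ j i) ∧
    qPow τ (-(1 / 4 : ℚ) * ((m : ℚ) ^ 2 - (ℓ : ℚ) ^ 2)) * eulerJ 1 τ ^ 3 * stringC 1 m ℓ τ
      = eulerJ 1 τ ^ 2 := by
  obtain ⟨p, hp⟩ := hm.symm.dvd
  obtain rfl : m = 2 * p + ℓ := by linarith
  refine ⟨fun j => ?_, ?_, ?_⟩
  · simp only [stringTerm_one]
    exact ((summable_partialThetaTerm τ _).sub (summable_partialThetaTerm τ _)).mul_left _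
  · simp only [tsum_stringTerm_one, mul_sub]
    have hs : Summable fun j : ℤ => qPow τ (3 * (j : ℚ) ^ 2 + (ℓ + 1) * j) := by
      simpa using summable_qPow_quadratic τ (show (0 : ℚ) < 3 by norm_num) (ℓ + 1) 0
    exact (summable_mul_partialTheta τ hs _).sub (summable_mul_partialTheta τ hs _)
  · have h := eulerJ_mul_tsum_stringTerm τ hℓ p
    have h0 := eulerJ_one_ne_zero τ
    have hq : qPow τ (-(1 / 4 : ℚ) * (((2 * p + ℓ : ℤ) : ℚ) ^ 2 - (ℓ : ℚ) ^ 2)) *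
        qPow τ ((p : ℚ) ^ 2 + p * ℓ) = 1 := by
      -- The exponents cancel because (m² - ℓ²)/4 = p² + pℓ for m = 2p + ℓ.
      rw [← qPow_add, ← qPow_zero τ]
      congr 1
      push_cast
      ring
    refine mul_left_cancel₀ h0 ?_
    rw [stringC, mul_assoc (qPow τ _), ← mul_assoc (eulerJ 1 τ ^ 3),
      mul_one_div_cancel (pow_ne_zero 3 h0), one_mul, mul_left_comm, h]
    linear_combination eulerJ 1 τ ^ 3 * hq
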